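/- Let $J$ be a Jacobi operator, i.e. a bounded operator on $\ell^2=\ell^2(\{0,1,2,\dots\})$ given by a real symmetric tridiagonal matrix with diagonal entries $\alpha_k$ and off-diagonal entries $\beta_k>0$ ($k\ge 0$), and let $\Delta$ be the free Jacobi operator ($\alpha_k=0$, $\beta_k=\tfrac12$ for all $k$). The orthonormal polynomials $P_k$ of $J$ are defined by $P_0=1$, $P_{-1}=0$ and $sP_k(s)=\beta_{k-1}P_{k-1}(s)+\alpha_kP_k(s)+\beta_kP_{k+1}(s)$; let $U_k$ be those of $\Delta$. The connection coefficient matrix $C=C_{J\to\Delta}=(c_{ij})_{i,j\ge 0}$ is the upper triangular matrix with $P_k=c_{0k}U_0+c_{1k}U_1+\dots+c_{kk}U_k$ for all $k$. For $r>0$ let $\ell^1_r$ be the Banach space of complex sequences $v$ with $\|v\|=\sum_{k\ge0}|v_k|r^k<\infty$. For $m\ge 0$ let $J^{[m]}$ be the Jacobi operator whose $(i,j)$ entry is that of $J$ if $0\le i,j<m$ and that of $\Delta$ otherwise, and let $C^{[m]}=C_{J^{[m]}\to\Delta}$. Theorem 5.8. Suppose that $J=\Delta+K$ with $K$ trace class,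 i.e. $\sum_k\langle e_k,(K^*K)^{1/2}e_k\rangle<\infty$. Then $C$ can be decomposed into $$C=C_{\rm Toe}+C_{\rm com},$$ with matrices $C_{\rm Toe}$, $C_{\rm com}$ independent of $R$, where $C_{\rm Toe}$ is upper triangular, Toeplitz and bounded as an operator from $\ell^1_{R^{-1}}$ to $\ell^1_{R^{-1}}$, and $C_{\rm com}$ is compact as an operator from $\ell^1_{R^{-1}}$ to $\ell^1_{R^{-1}}$, for all $R\in(0,1)$. Moreover each $C^{[m]}$ has a decomposition $C^{[m]}=C^{[m]}_{\rm Toe}+C^{[m]}_{\rm com}$ with the same properties, in which $C^{[m]}_{\rm com}$ has only finitely many nonzero entries, and, for all $R\in(0,1)$, $$C^{[m]}\to C,\qquad C^{[m]}_{\rm Toe}\to C_{\rm Toe},\qquad C^{[m]}_{\rm com}\to C_{\rm com}\qquad\text{as } m\to\infty$$ in the operator norm on $\ell^1_{R^{-1}}$. -/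

import Mathlib

open Polynomial Filter Topology

noncomputable section

/-! ### Jacobi operators -/

/-- A bounded Jacobi operator, given by its coefficients: the diagonal `α` and the strictly positive
off-diagonal `β` of a real symmetric tridiagonal matrix with bounded entries. -/
structure JacobiOperator where
  α : ℕ → ℝ
  β : ℕ → ℝ
  β_pos : ∀ k, 0 < β k
  bounded : ∃ B : ℝ, ∀ k, |α k| ≤ B ∧ |β k| ≤ B

namespace JacobiOperator

/-- The tridiagonal matrix, indexed from `0`, of a Jacobi operator. -/
def matrix (J : JacobiOperator) : Matrix ℕ ℕ ℝ := fun i j =>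
  if i = j then J.α i else if j = i + 1 then J.β i else if i = j + 1 then J.β j else 0

/-- The free Jacobi operator `Δ`. -/
def free : JacobiOperator where
  α _ := 0
  β _ := 1 / 2
  β_pos _ := by norm_num
  bounded := ⟨1, fun _ => by norm_num [abs_of_pos]⟩

/-- The Toeplitz-plus-finite-rank truncation `J^[m]`: the entries with both indices `< m` are those
of `J`, all the others are those of `Δ` (see `truncation_matrix`). -/
def truncation (J : JacobiOperator) (m : ℕ) : JacobiOperator where
  α k := if k < m then J.α k else 0
  β k := if k + 1 < m then J.β k else 1 / 2
  β_pos k := by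
    split_ifs
    · exact J.β_pos k
    · norm_num
  bounded := by
    obtain ⟨B, hB⟩ := J.bounded
    refine ⟨max B 1, fun k => ⟨?_, ?_⟩⟩
    · split_ifs
      · exact (hB k).1.trans (le_max_left _ _)
      · simp
    · split_ifs
      · exact (hB k).2.trans (le_max_left _ _)
      · refine le_trans ?_ (le_max_right _ _)
        norm_num [abs_of_pos]

theorem truncation_matrix (J : JacobiOperator) (m i j : ℕ) :
    (J.truncation m).matrix i j = if i < m ∧ j < m then J.matrix i j else free.matrix i j := by
  unfold matrix truncation free
  grind

/-- The orthonormal polynomials of a Jacobi operator: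
`P₀ = 1`, `s P₀ = α₀ P₀ + β₀ P₁` and `s Pₖ = βₖ₋₁ Pₖ₋₁ + αₖ Pₖ + βₖ Pₖ₊₁`. -/
def poly (J : JacobiOperator) : ℕ → ℝ[X]
  | 0 => 1
  | 1 => C (J.β 0)⁻¹ * ((X - C (J.α 0)) * 1)
  | k + 2 => C (J.β (k + 1))⁻¹ *
      ((X - C (J.α (k + 1))) * poly J (k + 1) - C (J.β k) * poly J k)

theorem degree_poly (J : JacobiOperator) : ∀ k, (J.poly k).degree = k
  | 0 => by simp [poly]
  | 1 => by
    have h : (J.β 0)⁻¹ ≠ 0 := inv_ne_zero (J.β_pos 0).ne'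
    rw [poly, degree_mul, degree_C h, mul_one, degree_X_sub_C]
    rfl
  | k + 2 => by
    have h : (J.β (k + 1))⁻¹ ≠ 0 := inv_ne_zero (J.β_pos _).ne'
    have h1 : ((X - C (J.α (k + 1))) * J.poly (k + 1)).degree = ((k + 2 : ℕ) : WithBot ℕ) := by
      rw [degree_mul, degree_X_sub_C, degree_poly J (k + 1)]
      push_cast
      ring
    have h2 : (C (J.β k) * J.poly k).degree < ((k + 2 : ℕ) : WithBot ℕ) := by
      rw [degree_mul, degree_C (J.β_pos k).ne', degree_poly J k, zero_add]
      exact_mod_cast (by omega : k < k + 2)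
    rw [poly, degree_mul, degree_C h, zero_add, degree_sub_eq_left_of_degree_lt (by rwa [h1]), h1]

/-- The orthonormal polynomials as a polynomial sequence (`degree Pₖ = k`). -/
def polySeq (J : JacobiOperator) : Polynomial.Sequence ℝ := ⟨J.poly, J.degree_poly⟩

/-- The orthonormal polynomials as a basis of `ℝ[X]`. -/
def polyBasis (J : JacobiOperator) : Module.Basis ℕ ℝ ℝ[X] :=
  J.polySeq.basis fun i => (leadingCoeff_ne_zero.mpr (J.polySeq.ne_zero i)).isUnit

theorem polyBasis_apply (J : JacobiOperator) (i : ℕ) : J.polyBasis i = J.poly i :=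
  J.polySeq.basis_eq_self _ i

/-- The connection coefficient matrix `C_{J → D}`: its entry `c_{ik}` is the coefficient of `Qᵢ` in
the expansion of `Pₖ`, where `P`, `Q` are the orthonormal polynomials of `J`, `D`. -/
def connection (J D : JacobiOperator) : Matrix ℕ ℕ ℝ := fun i k => D.polyBasis.repr (J.poly k) i

end JacobiOperator

/-! ### Matrices indexed by `ℕ` -/

def IsUpperTriangular (M : Matrix ℕ ℕ ℝ) : Prop := ∀ i j, j < i → M i j = 0

def IsToeplitz (M : Matrix ℕ ℕ ℝ) : Prop := ∀ i j, M (i + 1) (j + 1) = M i j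

namespace JacobiOperator

theorem connection_upperTriangular (J D : JacobiOperator) : IsUpperTriangular (J.connection D) := by
  intro i k hki
  have hmem : J.poly k ∈ Submodule.span ℝ (D.polySeq '' Set.Iic k) := by
    rw [D.polySeq.span_degreeLE
      fun i _ => (leadingCoeff_ne_zero.mpr (D.polySeq.ne_zero i)).isUnit, mem_degreeLE,
      J.degree_poly]
  have himg : D.polySeq '' Set.Iic k = D.polyBasis '' Set.Iic k :=
    Set.image_congr fun i _ => (D.polyBasis_apply i).symm
  rw [himg, Module.Basis.mem_span_image] at hmem
  by_contra hne
  have : i ≤ k := hmem (Finsupp.mem_support_iff.mpr hne)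
  omega

/-- `Pₖ = c_{0k} Q₀ + ⋯ + c_{kk} Qₖ`. -/
theorem poly_eq_sum_connection (J D : JacobiOperator) (k : ℕ) :
    J.poly k = ∑ i ∈ Finset.range (k + 1), J.connection D i k • D.poly i := by
  conv_lhs => rw [← D.polyBasis.linearCombination_repr (J.poly k)]
  rw [Finsupp.linearCombination_apply, Finsupp.sum]
  simp only [D.polyBasis_apply]
  refine Finset.sum_subset (fun i hi => ?_) (fun i _ hi => ?_)
  · by_contra h
    exact Finsupp.mem_support_iff.mp hi
      (J.connection_upperTriangular D i k (by simpa using h))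
  · rw [Finsupp.notMem_support_iff.mp hi, zero_smul]

end JacobiOperator

/-! ### Trace class operators on `ℓ²` -/

/-- The complex Hilbert space `ℓ²` of sequences indexed by `ℕ`. -/
abbrev EllTwo : Type := lp (fun _ : ℕ => ℂ) 2

/-- The standard orthonormal basis vector `e k` of `ℓ²`. -/
def stdE (k : ℕ) : EllTwo := lp.single 2 k (1 : ℂ)

/-- `∑ₖ ⟨eₖ, (K* K)^{1/2} eₖ⟩ < ∞`, for an operator `K` on a Hilbert space with orthonormal basis
`e`; the summands are nonnegative real numbers, and `CFC.abs K` is the square root of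
`star K * K`. -/
def IsTraceClassWrt {H : Type*} [NormedAddCommGroup H] [InnerProductSpace ℂ H] [CompleteSpace H]
    (e : ℕ → H) (K : H →L[ℂ] H) : Prop :=
  Summable fun k : ℕ => inner ℂ (e k) (CFC.abs K (e k))

/-- `K : ℓ² → ℓ²` is trace class. -/
def IsTraceClass (K : EllTwo →L[ℂ] EllTwo) : Prop := IsTraceClassWrt stdE K

/-! ### Geometrically weighted `ℓ¹` spaces -/

/-- The sequences with `∑ₖ |vₖ| r^k < ∞`. -/
def ellOneSubmodule (r : {r : ℝ // 0 < r}) : Submodule ℂ (ℕ → ℂ) where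
  carrier := {v | Summable fun k => ‖v k‖ * r.1 ^ k}
  zero_mem' := by simp [summable_zero]
  add_mem' {v w} hv hw := by
    refine Summable.of_nonneg_of_le
      (fun k => mul_nonneg (norm_nonneg _) (pow_nonneg r.2.le k)) (fun k => ?_) (hv.add hw)
    rw [← add_mul]
    exact mul_le_mul_of_nonneg_right (norm_add_le _ _) (pow_nonneg r.2.le k)
  smul_mem' c v hv := by
    have h : Summable fun k => ‖c‖ * (‖v k‖ * r.1 ^ k) := Summable.mul_left ‖c‖ hv
    simpa [mul_assoc] using h

/-- The space `ℓ¹_r`, with the norm `∑ₖ |vₖ| r^k`. -/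
def EllOne (r : {r : ℝ // 0 < r}) : Type := ↥(ellOneSubmodule r)

namespace EllOne

variable {r : {r : ℝ // 0 < r}}

instance : AddCommGroup (EllOne r) := inferInstanceAs (AddCommGroup ↥(ellOneSubmodule r))

instance : Module ℂ (EllOne r) := inferInstanceAs (Module ℂ ↥(ellOneSubmodule r))

instance : CoeFun (EllOne r) (fun _ => ℕ → ℂ) := ⟨Subtype.val⟩

instance : Norm (EllOne r) := ⟨fun v => ∑' k, ‖v k‖ * r.1 ^ k⟩

theorem summable (v : EllOne r) : Summable fun k => ‖v k‖ * r.1 ^ k := v.2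

theorem norm_def (v : EllOne r) : ‖v‖ = ∑' k, ‖v k‖ * r.1 ^ k := rfl

theorem add_apply (v w : EllOne r) (k : ℕ) : (v + w) k = v k + w k := rfl

theorem smul_apply (c : ℂ) (v : EllOne r) (k : ℕ) : (c • v) k = c * v k := rfl

theorem normCore : NormedSpace.Core ℂ (EllOne r) where
  norm_nonneg v := tsum_nonneg fun k => mul_nonneg (norm_nonneg _) (pow_nonneg r.2.le k)
  norm_smul c v := by
    rw [norm_def, norm_def, ← tsum_mul_left]
    simp only [smul_apply, norm_mul, mul_assoc]
  norm_triangle v w := by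
    rw [norm_def, norm_def, norm_def, ← v.summable.tsum_add w.summable]
    refine (v + w).summable.tsum_le_tsum (fun k => ?_) (v.summable.add w.summable)
    rw [← add_mul, add_apply]
    exact mul_le_mul_of_nonneg_right (norm_add_le _ _) (pow_nonneg r.2.le k)
  norm_eq_zero_iff v := by
    have hnn : ∀ k, 0 ≤ ‖v k‖ * r.1 ^ k :=
      fun k => mul_nonneg (norm_nonneg _) (pow_nonneg r.2.le k)
    constructor
    · intro h
      have h0 : HasSum (fun k => ‖v k‖ * r.1 ^ k) 0 := by
        rw [norm_def] at h
        simpa [h] using v.summable.hasSum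
      have h1 := (hasSum_zero_iff_of_nonneg hnn).mp h0
      refine Subtype.ext (funext fun k => ?_)
      have h2 : ‖v k‖ * r.1 ^ k = 0 := congrFun h1 k
      exact norm_eq_zero.mp ((mul_eq_zero.mp h2).resolve_right (pow_pos r.2 k).ne')
    · rintro rfl
      have h0 : ∀ k, (0 : EllOne r) k = 0 := fun _ => rfl
      simp [norm_def, h0]

instance : NormedAddCommGroup (EllOne r) := NormedAddCommGroup.ofCore normCore

instance : NormedSpace ℂ (EllOne r) := NormedSpace.ofCore normCore

end EllOne

/-! ### Infinite matrices as operators on `ℓ¹_r` -/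

/-- The bounded operator `A` on `ℓ¹_r` is given by the matrix `M`:
`(A v)ᵢ = ∑ⱼ Mᵢⱼ vⱼ`, with convergent series, for every `v ∈ ℓ¹_r`. -/
def Represents {r : {r : ℝ // 0 < r}} (M : Matrix ℕ ℕ ℝ) (A : EllOne r →L[ℂ] EllOne r) : Prop :=
  ∀ (v : EllOne r) (i : ℕ), HasSum (fun j => (M i j : ℂ) * v j) (A v i)

/-- `M` is bounded as an operator from `ℓ¹_r` to `ℓ¹_r`. -/
def IsBoundedOn (r : {r : ℝ // 0 < r}) (M : Matrix ℕ ℕ ℝ) : Prop :=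
  ∃ A : EllOne r →L[ℂ] EllOne r, Represents M A

/-- `M` is compact as an operator from `ℓ¹_r` to `ℓ¹_r`. -/
def IsCompactOn (r : {r : ℝ // 0 < r}) (M : Matrix ℕ ℕ ℝ) : Prop :=
  ∃ A : EllOne r →L[ℂ] EllOne r, Represents M A ∧ IsCompactOperator A

/-- The matrices `M m` and `L` are bounded operators on `ℓ¹_r`, and `M m → L` in the operator norm
topology as `m → ∞`. -/
def ConvergesOn (r : {r : ℝ // 0 < r}) (M : ℕ → Matrix ℕ ℕ ℝ) (L : Matrix ℕ ℕ ℝ) : Prop :=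
  ∃ (A : ℕ → EllOne r →L[ℂ] EllOne r) (B : EllOne r →L[ℂ] EllOne r),
    (∀ m, Represents (M m) (A m)) ∧ Represents L B ∧ Tendsto A atTop (𝓝 B)

/-- `C = T + S` with `T` upper triangular, Toeplitz and bounded on `ℓ¹_{R⁻¹}`, and `S` compact on
`ℓ¹_{R⁻¹}`, for all `R ∈ (0,1)` (the matrices do not depend on `R`). -/
structure IsToeplitzPlusCompact (C T S : Matrix ℕ ℕ ℝ) : Prop where
  eq_add : C = T + S
  upperTriangular : IsUpperTriangular T
  toeplitz : IsToeplitz T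
  bounded : ∀ (R : ℝ) (hR : 0 < R), R < 1 → IsBoundedOn ⟨R⁻¹, inv_pos.mpr hR⟩ T
  compact : ∀ (R : ℝ) (hR : 0 < R), R < 1 → IsCompactOn ⟨R⁻¹, inv_pos.mpr hR⟩ S

end

/-! For self-adjoint `K`, twice |Re ⟨x, K y⟩| is at most ⟨x, |K| x⟩ + ⟨y, |K| y⟩. Trace class
therefore forces ∑ |αₖ| and ∑ |βₖ - 1/2| to be finite, and nothing else about `K` is used.

Read column j of C upwards from the diagonal, normalised to begin with 1, as a sequence eⱼ. With S
the right shift and dⱼ = eⱼ₊₁ - eⱼ, the relation C J = Δ C gives dⱼ₊₁ = S² dⱼ - (4βⱼ² - 1) S² eⱼ -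
2αⱼ₊₁ S eⱼ₊₁ on the entries inside the column (`scaledDiag_diff_succ`). Since S contracts ℓ¹_R by R
< 1, a Gronwall argument makes ∑ ‖dⱼ‖ finite (`summable_majorant`). Undoing the normalisation costs
a bounded product with summable increments, so the columns converge in ℓ¹_R. Their limit is the
Toeplitz part.

Operators on ℓ¹_{R⁻¹} are controlled by their columns, and reading a column upwards turns its
relative norm into an ℓ¹_R norm (`columnBound_ofSuperdiagonals`). The truncation J^[m] obeys the
same bounds as J, shares its columns up to m - 1, and has constant columns from 2m on. So C^[m] is
Toeplitz plus a finite matrix, uniform tails give norm convergence, and the compact part of C is a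
norm limit of finite-rank operators. -/

noncomputable section

/-! ### Completeness of ℓ¹_r and finite-rank operators -/

namespace EllOne

variable {r : {r : ℝ // 0 < r}}

theorem sub_apply (v w : EllOne r) (k : ℕ) : (v - w) k = v k - w k := rfl

theorem norm_coord_le (v : EllOne r) (k : ℕ) : ‖v k‖ ≤ (r.1 ^ k)⁻¹ * ‖v‖ := by
  have h : ‖v k‖ * r.1 ^ k ≤ ‖v‖ :=
    v.summable.le_tsum k fun j _ => mul_nonneg (norm_nonneg _) (pow_nonneg r.2.le j)
  rw [inv_mul_eq_div, le_div_iff₀ (pow_pos r.2 k)]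
  exact h

/-- The coordinate functionals on `ℓ¹_r`. -/
def coord (k : ℕ) : EllOne r →L[ℂ] ℂ :=
  LinearMap.mkContinuous
    { toFun := fun v => v k
      map_add' := fun _ _ => rfl
      map_smul' := fun _ _ => rfl } (r.1 ^ k)⁻¹ fun v => v.norm_coord_le k

/-- Rescaling identifies `ℓ¹_r` with `ℓ¹`. -/
def equivLp (r : {r : ℝ // 0 < r}) : EllOne r ≃ lp (fun _ : ℕ => ℂ) 1 where
  toFun v := ⟨fun k => v k * (r.1 : ℂ) ^ k, memℓp_gen <| by
    simpa [abs_of_pos r.2] using v.summable⟩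
  invFun w := ⟨fun k => w k / (r.1 : ℂ) ^ k, by
    have h := (memℓp_gen_iff (by norm_num)).mp (lp.memℓp w)
    change Summable fun k => ‖w k / (r.1 : ℂ) ^ k‖ * r.1 ^ k
    refine (by simpa using h : Summable fun k => ‖w k‖).congr fun k => ?_
    rw [norm_div, norm_pow, Complex.norm_real, Real.norm_of_nonneg r.2.le,
      div_mul_cancel₀ _ (pow_pos r.2 k).ne']⟩
  left_inv v := Subtype.ext <| funext fun k =>
    mul_div_cancel_right₀ _ (pow_ne_zero k (Complex.ofReal_ne_zero.mpr r.2.ne'))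
  right_inv w := Subtype.ext <| funext fun k =>
    div_mul_cancel₀ _ (pow_ne_zero k (Complex.ofReal_ne_zero.mpr r.2.ne'))

theorem isometry_equivLp : Isometry (equivLp r) := by
  refine Isometry.of_dist_eq fun v w => ?_
  rw [dist_eq_norm, dist_eq_norm, lp.norm_eq_tsum_rpow (by norm_num), norm_def]
  simp only [ENNReal.toReal_one, Real.rpow_one, div_one]
  refine tsum_congr fun k => ?_
  change ‖v k * (r.1 : ℂ) ^ k - w k * (r.1 : ℂ) ^ k‖ = _
  rw [← sub_mul, norm_mul, norm_pow, Complex.norm_real, Real.norm_of_nonneg r.2.le, sub_apply]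

/-- Needed so that norm limits of compact operators are compact. -/
instance : CompleteSpace (EllOne r) :=
  (completeSpace_congr (isometry_equivLp (r := r)).isUniformEmbedding).mpr inferInstance

/-- Extension by zero of finite sequences to `ℓ¹_r`. -/
def ofFin (r : {r : ℝ // 0 < r}) (N : ℕ) : (Fin N → ℂ) →ₗ[ℂ] EllOne r where
  toFun w := ⟨fun k => if h : k < N then w ⟨k, h⟩ else 0,
    summable_of_ne_finset_zero (s := Finset.range N) fun k hk => by
      simp [show ¬ k < N by simpa using hk]⟩
  map_add' v w := Subtype.ext <| funext fun k => by
    change (if h : k < N then (v + w) ⟨k, h⟩ else 0) =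
      (if h : k < N then v ⟨k, h⟩ else 0) + (if h : k < N then w ⟨k, h⟩ else 0)
    split_ifs <;> simp
  map_smul' c w := Subtype.ext <| funext fun k => by
    change (if h : k < N then (c • w) ⟨k, h⟩ else 0) = c * (if h : k < N then w ⟨k, h⟩ else 0)
    split_ifs <;> simp

theorem ofFin_apply (N : ℕ) (w : Fin N → ℂ) (k : ℕ) :
    ofFin r N w k = if h : k < N then w ⟨k, h⟩ else 0 := rfl

/-- An operator whose values are all supported in `{0, …, N - 1}` is compact. -/
theorem isCompactOperator_of_support (A : EllOne r →L[ℂ] EllOne r) (N : ℕ)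
    (h : ∀ v i, N ≤ i → A v i = 0) : IsCompactOperator A := by
  let Q : EllOne r →L[ℂ] (Fin N → ℂ) := ContinuousLinearMap.pi fun i => (coord i.1).comp A
  have hQ : IsCompactOperator Q := isCompactOperator_of_locallyCompactSpace_dom Q
  have hA : A = (LinearMap.toContinuousLinearMap (ofFin r N)).comp Q := by
    ext v
    refine Subtype.ext (funext fun i => ?_)
    change A v i = ofFin r N (Q v) i
    rw [ofFin_apply]
    split_ifs with hi
    · rfl
    · exact h v i (not_lt.mp hi)
  rw [hA]
  exact hQ.clm_comp (LinearMap.toContinuousLinearMap (ofFin r N))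

end EllOne

/-! ### Operators on ℓ¹_r controlled by the columns of their matrices -/

section Represents

variable {r : {r : ℝ // 0 < r}} {M L : Matrix ℕ ℕ ℝ} {A B : EllOne r →L[ℂ] EllOne r}

theorem Represents.unique (hA : Represents M A) (hB : Represents M B) : A = B := by
  ext v
  exact Subtype.ext (funext fun i => (hA v i).unique (hB v i))

theorem Represents.sub (hA : Represents M A) (hB : Represents L B) :
    Represents (M - L) (A - B) := fun v i => by
  have h := (hA v i).sub (hB v i)
  simp only [← sub_mul, ← Complex.ofReal_sub] at h
  exact h

/-- The columns of `M`, restricted to finitely many rows, have `ℓ¹_r`-norm at most `b` times that of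
the corresponding basis vector. -/
def ColumnBound (r : {r : ℝ // 0 < r}) (M : Matrix ℕ ℕ ℝ) (b : ℝ) : Prop :=
  ∀ j n, ∑ i ∈ Finset.range n, |M i j| * r.1 ^ i ≤ b * r.1 ^ j

/-- On a weighted ℓ¹ space the columns are the images of the basis vectors, and by Tonelli a uniform
bound on them, relative to those vectors, bounds the whole operator. -/
theorem ColumnBound.exists_represents {b : ℝ} (hM : ColumnBound r M b) :
    ∃ A : EllOne r →L[ℂ] EllOne r, Represents M A ∧ ‖A‖ ≤ b := by
  have hr : ∀ k, 0 < r.1 ^ k := pow_pos r.2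
  have hb : 0 ≤ b := by simpa using hM 0 0
  have hcol0 : ∀ i j, 0 ≤ |M i j| * r.1 ^ i := fun i j => mul_nonneg (abs_nonneg _) (hr i).le
  have hcol : ∀ j, Summable fun i => |M i j| * r.1 ^ i := fun j =>
    summable_of_sum_range_le (fun i => hcol0 i j) (hM j)
  have hcolle : ∀ j, ∑' i, |M i j| * r.1 ^ i ≤ b * r.1 ^ j := fun j =>
    Real.tsum_le_of_sum_range_le (fun i => hcol0 i j) (hM j)
  have hle : ∀ (v : EllOne r) j,
      ‖v j‖ * ∑' i, |M i j| * r.1 ^ i ≤ b * (‖v j‖ * r.1 ^ j) := fun v j => by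
    calc _ ≤ ‖v j‖ * (b * r.1 ^ j) := mul_le_mul_of_nonneg_left (hcolle j) (norm_nonneg _)
      _ = _ := by ring
  have hcolsum : ∀ v : EllOne r, Summable fun j => ‖v j‖ * ∑' i, |M i j| * r.1 ^ i := fun v =>
    Summable.of_nonneg_of_le
      (fun j => mul_nonneg (norm_nonneg _) (tsum_nonneg fun i => hcol0 i j)) (hle v)
      (v.summable.mul_left b)
  -- Absolute summability over all index pairs follows column by column; exchanging the order then
  -- gives convergence of every row series.
  have hprod : ∀ v : EllOne r,
      Summable fun p : ℕ × ℕ => ‖v p.1‖ * (|M p.2 p.1| * r.1 ^ p.2) := fun v => by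
    have h0 : (0 : ℕ × ℕ → ℝ) ≤ fun p => ‖v p.1‖ * (|M p.2 p.1| * r.1 ^ p.2) := fun p =>
      mul_nonneg (norm_nonneg _) (hcol0 _ _)
    refine (summable_prod_of_nonneg h0).mpr ⟨fun j => Summable.mul_left ‖v j‖ (hcol j), ?_⟩
    simpa only [tsum_mul_left] using hcolsum v
  have hswap : ∀ v : EllOne r,
      Summable fun p : ℕ × ℕ => ‖v p.2‖ * (|M p.1 p.2| * r.1 ^ p.1) := fun v => (hprod v).prod_symm
  have hfac : ∀ (v : EllOne r) i, Summable fun j => ‖v j‖ * (|M i j| * r.1 ^ i) := fun v i =>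
    (hswap v).prod_factor i
  have hfacsum : ∀ v : EllOne r, Summable fun i => ∑' j, ‖v j‖ * (|M i j| * r.1 ^ i) := fun v =>
    (hswap v).prod
  have hrow : ∀ (v : EllOne r) i, Summable fun j => (M i j : ℂ) * v j := fun v i => by
    refine Summable.of_norm (((hfac v i).mul_right (r.1 ^ i)⁻¹).congr fun j => ?_)
    rw [norm_mul, Complex.norm_real, Real.norm_eq_abs, ← mul_assoc,
      mul_inv_cancel_right₀ (hr i).ne', mul_comm]
  have hnorm : ∀ (v : EllOne r) i,
      ‖∑' j, (M i j : ℂ) * v j‖ * r.1 ^ i ≤ ∑' j, ‖v j‖ * (|M i j| * r.1 ^ i) := fun v i => by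
    calc _ ≤ (∑' j, ‖(M i j : ℂ) * v j‖) * r.1 ^ i :=
          mul_le_mul_of_nonneg_right (norm_tsum_le_tsum_norm ((hrow v i).norm)) (hr i).le
      _ = ∑' j, ‖v j‖ * (|M i j| * r.1 ^ i) := by
          rw [← tsum_mul_right]
          refine tsum_congr fun j => ?_
          simp only [norm_mul, Complex.norm_real, Real.norm_eq_abs]
          ring
  have hmem : ∀ v : EllOne r, Summable fun i => ‖∑' j, (M i j : ℂ) * v j‖ * r.1 ^ i := fun v =>
    Summable.of_nonneg_of_le (fun i => mul_nonneg (norm_nonneg _) (hr i).le) (hnorm v)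
      (hfacsum v)
  let F : EllOne r →ₗ[ℂ] EllOne r :=
    { toFun := fun v => ⟨fun i => ∑' j, (M i j : ℂ) * v j, hmem v⟩
      map_add' := fun v w => Subtype.ext <| funext fun i => by
        change ∑' j, (M i j : ℂ) * (v + w) j = ∑' j, (M i j : ℂ) * v j + ∑' j, (M i j : ℂ) * w j
        rw [← (hrow v i).tsum_add (hrow w i)]
        exact tsum_congr fun j => by rw [EllOne.add_apply, mul_add]
      map_smul' := fun c v => Subtype.ext <| funext fun i => by
        change ∑' j, (M i j : ℂ) * (c • v) j = c * ∑' j, (M i j : ℂ) * v j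
        rw [← tsum_mul_left]
        exact tsum_congr fun j => by rw [EllOne.smul_apply]; ring }
  have hF : ∀ v, ‖F v‖ ≤ b * ‖v‖ := fun v => by
    calc ‖F v‖ = ∑' i, ‖∑' j, (M i j : ℂ) * v j‖ * r.1 ^ i := rfl
      _ ≤ ∑' i, ∑' j, ‖v j‖ * (|M i j| * r.1 ^ i) :=
          (hmem v).tsum_le_tsum (hnorm v) (hfacsum v)
      _ = ∑' j, ∑' i, ‖v j‖ * (|M i j| * r.1 ^ i) := (hprod v).tsum_comm
      _ ≤ ∑' j, b * (‖v j‖ * r.1 ^ j) := by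
          refine Summable.tsum_le_tsum (fun j => ?_) ?_ (v.summable.mul_left b)
          · rw [tsum_mul_left]
            exact hle v j
          · simpa only [tsum_mul_left] using hcolsum v
      _ = b * ‖v‖ := tsum_mul_left
  exact ⟨F.mkContinuous b hF, fun v i => (hrow v i).hasSum, F.mkContinuous_norm_le hb hF⟩

theorem Represents.norm_le {b : ℝ} (hA : Represents M A) (hM : ColumnBound r M b) : ‖A‖ ≤ b := by
  obtain ⟨B, hB, hle⟩ := hM.exists_represents
  rwa [hA.unique hB]

theorem ColumnBound.isBoundedOn {b : ℝ} (hM : ColumnBound r M b) : IsBoundedOn r M :=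
  hM.exists_represents.imp fun _ h => h.1

theorem convergesOn_of_columnBound {M : ℕ → Matrix ℕ ℕ ℝ} {ε : ℕ → ℝ}
    (hM : ∀ m, IsBoundedOn r (M m)) (hL : IsBoundedOn r L)
    (hbound : ∀ m, ColumnBound r (M m - L) (ε m)) (hε : Tendsto ε atTop (𝓝 0)) :
    ConvergesOn r M L := by
  choose A hA using hM
  obtain ⟨B, hB⟩ := hL
  refine ⟨A, B, hA, hB, ?_⟩
  rw [tendsto_iff_norm_sub_tendsto_zero]
  exact squeeze_zero (fun _ => norm_nonneg _) (fun m => ((hA m).sub hB).norm_le (hbound m)) hε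

theorem ConvergesOn.sub {M L : ℕ → Matrix ℕ ℕ ℝ} {M' L' : Matrix ℕ ℕ ℝ}
    (hM : ConvergesOn r M M') (hL : ConvergesOn r L L') :
    ConvergesOn r (fun m => M m - L m) (M' - L') := by
  obtain ⟨A, A', hA, hA', hAt⟩ := hM
  obtain ⟨B, B', hB, hB', hBt⟩ := hL
  exact ⟨fun m => A m - B m, A' - B', fun m => (hA m).sub (hB m), hA'.sub hB', hAt.sub hBt⟩

theorem Represents.isCompactOperator (hA : Represents M A)
    (hM : {p : ℕ × ℕ | M p.1 p.2 ≠ 0}.Finite) : IsCompactOperator A := by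
  obtain ⟨N, hN⟩ := (hM.image Prod.fst).bddAbove
  refine EllOne.isCompactOperator_of_support A (N + 1) fun v i hi => ?_
  have hzero : ∀ j, M i j = 0 := fun j => by
    by_contra h
    have := hN ⟨(i, j), h, rfl⟩
    simp only at this
    omega
  refine (hA v i).unique ?_
  simp [hzero]

theorem IsBoundedOn.isCompactOn (h : IsBoundedOn r M)
    (hM : {p : ℕ × ℕ | M p.1 p.2 ≠ 0}.Finite) : IsCompactOn r M :=
  h.imp fun _ hA => ⟨hA, hA.isCompactOperator hM⟩

/-- Finitely supported matrices act with finite rank, and compact operators are closed in norm. -/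
theorem ConvergesOn.isCompactOn {M : ℕ → Matrix ℕ ℕ ℝ} (h : ConvergesOn r M L)
    (hM : ∀ m, {p : ℕ × ℕ | M m p.1 p.2 ≠ 0}.Finite) : IsCompactOn r L := by
  obtain ⟨A, B, hA, hB, hAB⟩ := h
  exact ⟨B, hB, isCompactOperator_of_tendsto hAB
    (Eventually.of_forall fun m => (hA m).isCompactOperator (hM m))⟩

end Represents

/-! ### From trace class to summable coefficients -/

theorem inner_stdE_left (i : ℕ) (v : EllTwo) : inner ℂ (stdE i) v = v i := by
  simp [stdE, lp.inner_single_left]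

theorem isSelfAdjoint_of_entries {K : EllTwo →L[ℂ] EllTwo}
    (h : ∀ i j, inner ℂ (stdE i) (K (stdE j)) = inner ℂ (K (stdE i)) (stdE j)) :
    IsSelfAdjoint K := by
  refine lp.ext_continuousLinearMap (by norm_num) fun j => ?_
  ext i
  have h1 := h i j
  rw [← ContinuousLinearMap.adjoint_inner_right, inner_stdE_left, inner_stdE_left] at h1
  exact h1.symm

/-- A bound for the matrix entries of a self-adjoint operator by the diagonal ones of `|K|`. -/
theorem abs_re_inner_le_of_isSelfAdjoint {H : Type*} [NormedAddCommGroup H] [InnerProductSpace ℂ H]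
    [CompleteSpace H] {K : H →L[ℂ] H} (hK : IsSelfAdjoint K) (x y : H) :
    |(inner ℂ x (K y)).re| ≤
      ((inner ℂ x (CFC.abs K x)).re + (inner ℂ y (CFC.abs K y)).re) / 2 := by
  -- |K| ± K is twice the positive, respectively negative, part of `K`.
  have hplus : 0 ≤ CFC.abs K + K := by
    rw [CFC.abs_add_self K]
    exact nsmul_nonneg (CFC.posPart_nonneg K) 2
  have hminus : 0 ≤ CFC.abs K - K := by
    rw [CFC.abs_sub_self K]
    exact nsmul_nonneg (CFC.negPart_nonneg K) 2
  rw [ContinuousLinearMap.nonneg_iff_isPositive] at hplus hminus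
  have hp : ∀ z, 0 ≤ (inner ℂ z (CFC.abs K z)).re + (inner ℂ z (K z)).re := fun z => by
    have := hplus.re_inner_nonneg_right z
    simpa [inner_add_right] using this
  have hm : ∀ z, 0 ≤ (inner ℂ z (CFC.abs K z)).re - (inner ℂ z (K z)).re := fun z => by
    have := hminus.re_inner_nonneg_right z
    simpa [inner_sub_right] using this
  have hsymm : (inner ℂ y (K x)).re = (inner ℂ x (K y)).re := by
    rw [← ContinuousLinearMap.adjoint_inner_left, hK.adjoint_eq, ← inner_conj_symm,
      Complex.conj_re]
  -- Polarisation: adding the form of |K| + K at x ± y to that of |K| - K at x ∓ y cancels the cross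
  -- terms of |K| and leaves ±4 Re ⟨x, K y⟩.
  have h1 := hp (x + y)
  have h2 := hm (x - y)
  have h3 := hm (x + y)
  have h4 := hp (x - y)
  simp only [map_add, map_sub, inner_add_left, inner_add_right, inner_sub_left, inner_sub_right,
    Complex.add_re, Complex.sub_re] at h1 h2 h3 h4
  rw [abs_le]
  constructor <;> linarith

theorem IsTraceClassWrt.exists_summable_bound {H : Type*} [NormedAddCommGroup H]
    [InnerProductSpace ℂ H] [CompleteSpace H] {e : ℕ → H} {K : H →L[ℂ] H}
    (h : IsTraceClassWrt e K) (hK : IsSelfAdjoint K) :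
    ∃ w : ℕ → ℝ, Summable w ∧ ∀ i j, |(inner ℂ (e i) (K (e j))).re| ≤ (w i + w j) / 2 :=
  ⟨fun k => (inner ℂ (e k) (CFC.abs K (e k))).re, (Complex.hasSum_re (Summable.hasSum h)).summable,
    fun i j => abs_re_inner_le_of_isSelfAdjoint hK (e i) (e j)⟩

namespace JacobiOperator

variable {J : JacobiOperator} {K : EllTwo →L[ℂ] EllTwo}

theorem matrix_symm (J : JacobiOperator) (i j : ℕ) : J.matrix i j = J.matrix j i := by
  unfold matrix
  grind

theorem summable_of_isTraceClass
    (hJ : ∀ i j : ℕ, (J.matrix i j : ℂ) =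
      (free.matrix i j : ℂ) + inner ℂ (stdE i) (K (stdE j)))
    (hK : IsTraceClass K) :
    (Summable fun k => |J.α k|) ∧ Summable fun k => |J.β k - 1 / 2| := by
  have hentry : ∀ i j, inner ℂ (stdE i) (K (stdE j)) =
      ((J.matrix i j - free.matrix i j : ℝ) : ℂ) := fun i j => by
    rw [Complex.ofReal_sub, hJ i j]
    ring
  have hsa : IsSelfAdjoint K := isSelfAdjoint_of_entries fun i j => by
    rw [← inner_conj_symm (K (stdE i)), hentry, hentry, Complex.conj_ofReal,
      J.matrix_symm i j, free.matrix_symm i j]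
  obtain ⟨w, hsum, hw⟩ := IsTraceClassWrt.exists_summable_bound hK hsa
  have hle : ∀ i j, |J.matrix i j - free.matrix i j| ≤ (w i + w j) / 2 := fun i j => by
    simpa only [hentry, Complex.ofReal_re] using hw i j
  constructor
  · refine Summable.of_nonneg_of_le (fun _ => abs_nonneg _) (fun k => ?_)
      ((hsum.add hsum).div_const 2)
    simpa [matrix, free] using hle k k
  · refine Summable.of_nonneg_of_le (fun _ => abs_nonneg _) (fun k => ?_)
      ((hsum.add ((summable_nat_add_iff 1).mpr hsum)).div_const 2)
    simpa [matrix, free] using hle k (k + 1)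

end JacobiOperator

/-! ### Recurrences for the connection coefficients -/

namespace JacobiOperator

theorem X_mul_poly_zero (J : JacobiOperator) :
    X * J.poly 0 = J.β 0 • J.poly 1 + J.α 0 • J.poly 0 := by
  have h : C (J.β 0) * C (J.β 0)⁻¹ = 1 := by
    rw [← C_mul, mul_inv_cancel₀ (J.β_pos 0).ne', C_1]
  simp only [poly, smul_eq_C_mul]
  linear_combination -(X - C (J.α 0)) * h

theorem X_mul_poly_succ (J : JacobiOperator) (k : ℕ) :
    X * J.poly (k + 1) =
      J.β (k + 1) • J.poly (k + 2) + J.α (k + 1) • J.poly (k + 1) + J.β k • J.poly k := by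
  have h : C (J.β (k + 1)) * C (J.β (k + 1))⁻¹ = 1 := by
    rw [← C_mul, mul_inv_cancel₀ (J.β_pos _).ne', C_1]
  rw [poly]
  simp only [smul_eq_C_mul]
  linear_combination -((X - C (J.α (k + 1))) * J.poly (k + 1) - C (J.β k) * J.poly k) * h

theorem free_X_mul_zero : X * free.polyBasis 0 = (1 / 2 : ℝ) • free.polyBasis 1 := by
  simpa [polyBasis_apply, free] using free.X_mul_poly_zero

theorem free_X_mul_succ (k : ℕ) : X * free.polyBasis (k + 1) =
    (1 / 2 : ℝ) • free.polyBasis (k + 2) + (1 / 2 : ℝ) • free.polyBasis k := by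
  simpa [polyBasis_apply, free] using free.X_mul_poly_succ k

/-- Multiplication by `X` has matrix Δ in the basis Uₖ. By linearity it is enough to check this on
basis elements. -/
theorem free_repr_X_mul_zero (q : ℝ[X]) :
    free.polyBasis.repr (X * q) 0 = 1 / 2 * free.polyBasis.repr q 1 := by
  have h : free.polyBasis.coord 0 ∘ₗ LinearMap.mulLeft ℝ X =
      (1 / 2 : ℝ) • free.polyBasis.coord 1 := by
    refine free.polyBasis.ext fun k => ?_
    rcases k with _ | k
    · simp [free_X_mul_zero]
    · simp [free_X_mul_succ, Finsupp.single_apply]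
  simpa using LinearMap.congr_fun h q

theorem free_repr_X_mul_succ (q : ℝ[X]) (i : ℕ) :
    free.polyBasis.repr (X * q) (i + 1) =
      1 / 2 * free.polyBasis.repr q i + 1 / 2 * free.polyBasis.repr q (i + 2) := by
  have h : free.polyBasis.coord (i + 1) ∘ₗ LinearMap.mulLeft ℝ X =
      (1 / 2 : ℝ) • free.polyBasis.coord i + (1 / 2 : ℝ) • free.polyBasis.coord (i + 2) := by
    refine free.polyBasis.ext fun k => ?_
    rcases k with _ | k
    · simp [free_X_mul_zero, Finsupp.single_apply, eq_comm]
    · simp [free_X_mul_succ, Finsupp.single_apply]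
  simpa using LinearMap.congr_fun h q

variable (J : JacobiOperator)

theorem connection_free_zero_add_two (k : ℕ) :
    J.β (k + 1) * J.connection free 0 (k + 2) = 1 / 2 * J.connection free 1 (k + 1) -
      J.α (k + 1) * J.connection free 0 (k + 1) - J.β k * J.connection free 0 k := by
  have h := free_repr_X_mul_zero (J.poly (k + 1))
  rw [X_mul_poly_succ] at h
  simp only [map_add, map_smul, Finsupp.add_apply, Finsupp.smul_apply, smul_eq_mul] at h
  simp only [connection]
  linarith

theorem connection_free_succ_add_two (i k : ℕ) :
    J.β (k + 1) * J.connection free (i + 1) (k + 2) = 1 / 2 * J.connection free i (k + 1) +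
      1 / 2 * J.connection free (i + 2) (k + 1) -
      J.α (k + 1) * J.connection free (i + 1) (k + 1) - J.β k * J.connection free (i + 1) k := by
  have h := free_repr_X_mul_succ (J.poly (k + 1)) i
  rw [X_mul_poly_succ] at h
  simp only [map_add, map_smul, Finsupp.add_apply, Finsupp.smul_apply, smul_eq_mul] at h
  simp only [connection]
  linarith

theorem connection_free_zero_zero : J.connection free 0 0 = 1 := by
  have h : J.poly 0 = free.polyBasis 0 := by rw [polyBasis_apply, poly, poly]
  simp [connection, h]

theorem connection_free_zero_one : J.β 0 * J.connection free 0 1 = - J.α 0 := by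
  have h := free_repr_X_mul_zero (J.poly 0)
  have h1 := J.connection_upperTriangular free 1 0 one_pos
  have h0 := J.connection_free_zero_zero
  rw [X_mul_poly_zero] at h
  simp only [map_add, map_smul, Finsupp.add_apply, Finsupp.smul_apply, smul_eq_mul] at h
  simp only [connection] at *
  rw [h0, h1] at h
  linarith

theorem connection_free_one_one : J.β 0 * J.connection free 1 1 = 1 / 2 := by
  have h := free_repr_X_mul_succ (J.poly 0) 0
  have h1 := J.connection_upperTriangular free 1 0 one_pos
  have h2 := J.connection_upperTriangular free 2 0 two_pos
  have h0 := J.connection_free_zero_zero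
  rw [X_mul_poly_zero] at h
  simp only [map_add, map_smul, Finsupp.add_apply, Finsupp.smul_apply, smul_eq_mul] at h
  simp only [connection] at *
  simp only [zero_add] at h
  rw [h0, h1, h2] at h
  linarith

/-- `J.connDiag j k` is the entry of `C_{J → Δ}` in column `j` on the `k`-th superdiagonal. -/
def connDiag (j k : ℕ) : ℝ := if k ≤ j then J.connection free (j - k) j else 0

/-- The entries of `C_{J → Δ}` after multiplication of the orthonormal polynomials with constants
that make all diagonal entries equal to `1`. -/
def scaledDiag (j k : ℕ) : ℝ := (∏ l ∈ Finset.range j, 2 * J.β l) * J.connDiag j k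

end JacobiOperator

/-- The right shift of a sequence. -/
def rightShift (v : ℕ → ℝ) : ℕ → ℝ
  | 0 => 0
  | k + 1 => v k

/-! ### Columns read upwards from the diagonal -/

namespace JacobiOperator

variable (J : JacobiOperator)

theorem connDiag_zero (k : ℕ) : J.connDiag 0 k = if k = 0 then 1 else 0 := by
  rcases k with _ | k <;> simp [connDiag, connection_free_zero_zero]

theorem scaledDiag_zero (k : ℕ) : J.scaledDiag 0 k = if k = 0 then 1 else 0 := by
  simp [scaledDiag, connDiag_zero]

theorem scaledDiag_one (k : ℕ) :
    J.scaledDiag 1 k = if k = 0 then 1 else if k = 1 then - (2 * J.α 0) else 0 := by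
  rcases k with _ | _ | k
  · simp [scaledDiag, connDiag]
    linarith [J.connection_free_one_one]
  · simp [scaledDiag, connDiag]
    linarith [J.connection_free_zero_one]
  · simp [scaledDiag, connDiag]

theorem scaledDiag_diff_zero (k : ℕ) :
    J.scaledDiag 1 k - J.scaledDiag 0 k = if k = 1 then - (2 * J.α 0) else 0 := by
  rw [scaledDiag_zero, scaledDiag_one]
  grind

/-- The recurrence for the columns of `C_{J → Δ}`, a form of `C J = Δ C`. -/
theorem scaledDiag_add_two {j k : ℕ} (hk : k ≤ j + 2) :
    J.scaledDiag (j + 2) k = J.scaledDiag (j + 1) k +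
      rightShift (rightShift (J.scaledDiag (j + 1))) k -
      2 * J.α (j + 1) * rightShift (J.scaledDiag (j + 1)) k -
      4 * J.β j ^ 2 * rightShift (rightShift (J.scaledDiag j)) k := by
  have hut := J.connection_upperTriangular free
  rcases k with _ | _ | k
  · have h := J.connection_free_succ_add_two (j + 1) j
    rw [hut (j + 1 + 2) (j + 1) (by omega), hut (j + 1 + 1) (j + 1) (by omega),
      hut (j + 1 + 1) j (by omega)] at h
    simp only [scaledDiag, connDiag, rightShift, Finset.prod_range_succ, zero_le, if_true,
      Nat.sub_zero]
    linear_combination 4 * J.β j * (∏ l ∈ Finset.range j, 2 * J.β l) * h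
  · have h : J.β (j + 1) * J.connection free (j + 1) (j + 2) =
        1 / 2 * J.connDiag (j + 1) 1 - J.α (j + 1) * J.connection free (j + 1) (j + 1) := by
      have h := J.connection_free_succ_add_two j j
      rw [hut (j + 2) (j + 1) (by omega), hut (j + 1) j (by omega)] at h
      simp only [connDiag, le_add_iff_nonneg_left, zero_le, if_true, Nat.add_sub_cancel]
      linarith
    simp only [scaledDiag, rightShift, Finset.prod_range_succ, zero_add]
    simp only [connDiag, le_add_iff_nonneg_left, zero_le, if_true, Nat.sub_zero,
      show 1 ≤ j + 2 by omega, show j + 2 - 1 = j + 1 by omega] at h ⊢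
    linear_combination 4 * J.β j * (∏ l ∈ Finset.range j, 2 * J.β l) * h
  · obtain ⟨i, rfl⟩ : ∃ i, j = i + k := ⟨j - k, by omega⟩
    have h : J.β (i + k + 1) * J.connection free i (i + k + 2) =
        1 / 2 * J.connDiag (i + k + 1) (k + 2) + 1 / 2 * J.connection free (i + 1) (i + k + 1)
        - J.α (i + k + 1) * J.connection free i (i + k + 1)
        - J.β (i + k) * J.connection free i (i + k) := by
      -- In the top row there is no coefficient of index -1; the default value 0 of `connDiag` above
      -- the matrix stands in for it.
      rcases i with _ | i
      · have h := J.connection_free_zero_add_two (0 + k)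
        simp only [connDiag, show ¬ (k + 2 ≤ 0 + k + 1) by omega, if_false]
        linarith
      · have h := J.connection_free_succ_add_two i (i + 1 + k)
        simp only [connDiag, show k + 2 ≤ i + 1 + k + 1 by omega, if_true,
          show i + 1 + k + 1 - (k + 2) = i by omega]
        linarith
    simp only [scaledDiag, rightShift, Finset.prod_range_succ]
    simp only [connDiag, show k + 1 + 1 ≤ i + k + 2 by omega, show k ≤ i + k + 1 by omega,
      show k + 1 ≤ i + k + 1 by omega, show k ≤ i + k by omega, if_true,
      show i + k + 2 - (k + 1 + 1) = i by omega, show i + k + 1 - k = i + 1 by omega,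
      show i + k + 1 - (k + 1) = i by omega, show i + k - k = i by omega] at h ⊢
    linear_combination 4 * J.β (i + k) * (∏ l ∈ Finset.range (i + k), 2 * J.β l) * h

theorem scaledDiag_eq_zero {j k : ℕ} (h : j < k) : J.scaledDiag j k = 0 := by
  simp [scaledDiag, connDiag, not_le.mpr h]

/-- Splitting S² eⱼ₊₁ as S² (eⱼ₊₁ - eⱼ) + S² eⱼ exposes a contraction of the previous increment plus
terms with summable coefficients. -/
theorem scaledDiag_diff_succ {j k : ℕ} (hk : k ≤ j + 2) :
    J.scaledDiag (j + 2) k - J.scaledDiag (j + 1) k =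
      rightShift (rightShift fun l => J.scaledDiag (j + 1) l - J.scaledDiag j l) k -
      (4 * J.β j ^ 2 - 1) * rightShift (rightShift (J.scaledDiag j)) k -
      2 * J.α (j + 1) * rightShift (J.scaledDiag (j + 1)) k := by
  rw [J.scaledDiag_add_two hk]
  rcases k with _ | _ | k <;> simp only [rightShift] <;> ring

end JacobiOperator

/-- The norm of `ℓ¹_R` for the first `n` entries of a real sequence. -/
def partialNorm (R : ℝ) (n : ℕ) (v : ℕ → ℝ) : ℝ := ∑ k ∈ Finset.range n, |v k| * R ^ k

/-! ### Finite sections of the ℓ¹_R norm -/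

section partialNorm

variable {R : ℝ}

theorem partialNorm_nonneg (hR : 0 ≤ R) (n : ℕ) (v : ℕ → ℝ) : 0 ≤ partialNorm R n v :=
  Finset.sum_nonneg fun k _ => mul_nonneg (abs_nonneg _) (pow_nonneg hR k)

theorem partialNorm_mono (hR : 0 ≤ R) (n : ℕ) {v w : ℕ → ℝ} (h : ∀ k, |v k| ≤ |w k|) :
    partialNorm R n v ≤ partialNorm R n w :=
  Finset.sum_le_sum fun k _ => mul_le_mul_of_nonneg_right (h k) (pow_nonneg hR k)

theorem partialNorm_add_le (hR : 0 ≤ R) (n : ℕ) (v w : ℕ → ℝ) :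
    partialNorm R n (fun k => v k + w k) ≤ partialNorm R n v + partialNorm R n w := by
  rw [partialNorm, partialNorm, partialNorm, ← Finset.sum_add_distrib]
  refine Finset.sum_le_sum fun k _ => ?_
  rw [← add_mul]
  exact mul_le_mul_of_nonneg_right (abs_add_le _ _) (pow_nonneg hR k)

theorem partialNorm_smul (n : ℕ) (c : ℝ) (v : ℕ → ℝ) :
    partialNorm R n (fun k => c * v k) = |c| * partialNorm R n v := by
  simp only [partialNorm, Finset.mul_sum, abs_mul, mul_assoc]

theorem partialNorm_neg (n : ℕ) (v : ℕ → ℝ) : partialNorm R n (fun k => - v k) = partialNorm R n v := by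
  simp only [partialNorm, abs_neg]

theorem partialNorm_sub_le (hR : 0 ≤ R) (n : ℕ) (v w : ℕ → ℝ) :
    partialNorm R n (fun k => v k - w k) ≤ partialNorm R n v + partialNorm R n w := by
  simpa only [sub_eq_add_neg, partialNorm_neg] using partialNorm_add_le hR n v fun k => - w k

/-- Each entry moves up one place and gains a factor R; the last one leaves the window. -/
theorem partialNorm_rightShift_le (hR : 0 ≤ R) (n : ℕ) (v : ℕ → ℝ) :
    partialNorm R n (rightShift v) ≤ R * partialNorm R n v := by
  rcases n with _ | n
  · simp [partialNorm]
  · rw [partialNorm, Finset.sum_range_succ', partialNorm, Finset.sum_range_succ, mul_add,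
      Finset.mul_sum]
    simp only [rightShift, abs_zero, zero_mul, add_zero]
    refine le_add_of_le_of_nonneg (Finset.sum_le_sum fun k _ => ?_)
      (mul_nonneg hR (mul_nonneg (abs_nonneg _) (pow_nonneg hR n)))
    rw [pow_succ]
    exact le_of_eq (by ring)

end partialNorm

/-! ### A discrete Gronwall argument -/

section Majorant

/-- The solution of `X (j + 1) = X j + Y j`, `Y (j + 1) = ρ (Y j + B j X j) + A (j + 1) X (j + 1)`
with `X 0 = 1`, `Y 0 = A 0`, as a sequence of pairs. -/
def majorant (ρ : ℝ) (A B : ℕ → ℝ) : ℕ → ℝ × ℝ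
  | 0 => (1, A 0)
  | j + 1 => ((majorant ρ A B j).1 + (majorant ρ A B j).2,
      ρ * ((majorant ρ A B j).2 + B j * (majorant ρ A B j).1) +
        A (j + 1) * ((majorant ρ A B j).1 + (majorant ρ A B j).2))

variable {ρ : ℝ} {A B : ℕ → ℝ}

theorem majorant_nonneg (hρ : 0 ≤ ρ) (hA : ∀ j, 0 ≤ A j) (hB : ∀ j, 0 ≤ B j) (j : ℕ) :
    0 ≤ (majorant ρ A B j).1 ∧ 0 ≤ (majorant ρ A B j).2 := by
  induction j with
  | zero => exact ⟨zero_le_one, hA 0⟩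
  | succ j ih =>
    obtain ⟨h1, h2⟩ := ih
    have := hA (j + 1)
    have := hB j
    constructor <;> simp only [majorant] <;> positivity

/-- The extremal system depends only on ρ, `A` and `B`, so its bounds serve J and all its
truncations at once. -/
theorem le_majorant (hρ : 0 ≤ ρ) (hA : ∀ j, 0 ≤ A j) (hB : ∀ j, 0 ≤ B j) {x y : ℕ → ℝ}
    (hx0 : x 0 ≤ 1) (hy0 : y 0 ≤ A 0) (hx : ∀ j, x (j + 1) ≤ x j + y j)
    (hy : ∀ j, y (j + 1) ≤ ρ * (y j + B j * x j) + A (j + 1) * x (j + 1)) (j : ℕ) :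
    x j ≤ (majorant ρ A B j).1 ∧ y j ≤ (majorant ρ A B j).2 := by
  induction j with
  | zero => exact ⟨hx0, hy0⟩
  | succ j ih =>
    have h1 : x (j + 1) ≤ (majorant ρ A B (j + 1)).1 := (hx j).trans (add_le_add ih.1 ih.2)
    refine ⟨h1, (hy j).trans ?_⟩
    have h2 := mul_le_mul_of_nonneg_left ih.1 (hB j)
    have h3 := mul_le_mul_of_nonneg_left (add_le_add ih.2 h2) hρ
    exact add_le_add h3 (mul_le_mul_of_nonneg_left h1 (hA (j + 1)))

theorem exists_majorant_le (hρ : 0 ≤ ρ) (hρ1 : ρ < 1) (hA : ∀ j, 0 ≤ A j) (hB : ∀ j, 0 ≤ B j)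
    (hAs : Summable A) (hBs : Summable B) : ∃ b, ∀ j, (majorant ρ A B j).1 ≤ b := by
  -- With κ = 1/(1 - ρ) the quantity X + κ Y is preserved when A and B vanish; in general it grows
  -- by at most the factor 1 + κ (Bⱼ + Aⱼ₊₁).
  obtain ⟨κ, hκ, hκρ⟩ : ∃ κ : ℝ, 1 ≤ κ ∧ 1 + κ * ρ = κ := by
    have h : 0 < 1 - ρ := sub_pos.mpr hρ1
    refine ⟨(1 - ρ)⁻¹, (one_le_inv₀ h).mpr (by linarith), ?_⟩
    field_simp
    ring
  have hg : Summable fun j => κ * (B j + A (j + 1)) :=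
    (hBs.add ((summable_nat_add_iff 1).mpr hAs)).mul_left κ
  have hg0 : ∀ j, 0 ≤ κ * (B j + A (j + 1)) := fun j =>
    mul_nonneg (by linarith) (add_nonneg (hB j) (hA _))
  have hnn := fun j => majorant_nonneg hρ hA hB j
  have hQ : ∀ j, (majorant ρ A B j).1 + κ * (majorant ρ A B j).2 ≤
      (1 + κ * A 0) * ∏ l ∈ Finset.range j, (1 + κ * (B l + A (l + 1))) := fun j => by
    induction j with
    | zero => simp [majorant]
    | succ j ih =>
      obtain ⟨h1, h2⟩ := hnn j
      rw [Finset.prod_range_succ, ← mul_assoc]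
      refine le_trans ?_ (mul_le_mul_of_nonneg_right ih (by linarith [hg0 j]))
      simp only [majorant]
      generalize (majorant ρ A B j).1 = x at *
      generalize (majorant ρ A B j).2 = y at *
      -- `e1`, `e2` and `e3` are exactly the slack in this growth estimate.
      have e1 : 0 ≤ κ * (1 - ρ) * (B j * x) :=
        mul_nonneg (mul_nonneg (by linarith) (by linarith)) (mul_nonneg (hB j) h1)
      have e2 : 0 ≤ κ * (A (j + 1) * ((κ - 1) * y)) :=
        mul_nonneg (by linarith) (mul_nonneg (hA _) (mul_nonneg (by linarith) h2))
      have e3 : 0 ≤ κ * (B j * (κ * y)) :=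
        mul_nonneg (by linarith) (mul_nonneg (hB j) (mul_nonneg (by linarith) h2))
      linear_combination e1 + e2 + e3 + y * hκρ
  refine ⟨(1 + κ * A 0) * Real.exp (∑' j, κ * (B j + A (j + 1))), fun j => ?_⟩
  have h1 : 0 ≤ κ * (majorant ρ A B j).2 := mul_nonneg (by linarith) (hnn j).2
  have h2 : ∏ l ∈ Finset.range j, (1 + κ * (B l + A (l + 1))) ≤
      Real.exp (∑' j, κ * (B j + A (j + 1))) :=
    (Real.prod_one_add_le_exp_sum _ hg0).trans
      (Real.exp_le_exp.mpr (hg.sum_le_tsum _ fun l _ => hg0 l))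
  have h3 := mul_le_mul_of_nonneg_left h2
    (add_nonneg zero_le_one (mul_nonneg (by linarith) (hA 0)) : 0 ≤ 1 + κ * A 0)
  linarith [hQ j]

theorem summable_majorant (hρ : 0 ≤ ρ) (hρ1 : ρ < 1) (hA : ∀ j, 0 ≤ A j) (hB : ∀ j, 0 ≤ B j)
    (hAs : Summable A) (hBs : Summable B) : Summable fun j => (majorant ρ A B j).2 := by
  obtain ⟨b, hb⟩ := exists_majorant_le hρ hρ1 hA hB hAs hBs
  refine summable_of_sum_range_le (c := b - 1) (fun j => (majorant_nonneg hρ hA hB j).2) fun n => ?_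
  -- Y is the increment of X, so its sums telescope and boundedness of X suffices.
  have h : ∑ j ∈ Finset.range n, (majorant ρ A B j).2 = (majorant ρ A B n).1 - 1 := by
    induction n with
    | zero => simp [majorant]
    | succ n ih =>
      rw [Finset.sum_range_succ, ih, majorant]
      ring
  rw [h]
  linarith [hb n]

end Majorant

/-! ### Uniform bounds for the columns, and the truncations -/

namespace JacobiOperator

/-- The coefficients of `J` differ from those of `Δ` at most by the given sequences. -/
structure Dominated (J : JacobiOperator) (A B U : ℕ → ℝ) : Prop where
  diag : ∀ k, |2 * J.α k| ≤ A k
  offDiag : ∀ k, |4 * J.β k ^ 2 - 1| ≤ B k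
  ratio : ∀ k, |(2 * J.β k)⁻¹ - 1| ≤ U k

variable {J : JacobiOperator} {A B U : ℕ → ℝ} {R : ℝ}

theorem Dominated.scaledDiag_le (hJ : J.Dominated A B U) (hR : 0 < R) (hR1 : R < 1) (n j : ℕ) :
    partialNorm R n (J.scaledDiag j) ≤ (majorant (R ^ 2) A B j).1 ∧
      partialNorm R n (fun k => J.scaledDiag (j + 1) k - J.scaledDiag j k) ≤
        (majorant (R ^ 2) A B j).2 := by
  have hshift2 : ∀ v, partialNorm R n (rightShift (rightShift v)) ≤ R ^ 2 * partialNorm R n v := by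
    intro v
    have h := mul_le_mul_of_nonneg_left (partialNorm_rightShift_le hR.le n v) hR.le
    have h2 := partialNorm_rightShift_le hR.le n (rightShift v)
    nlinarith
  have hA : ∀ j, 0 ≤ A j := fun j => (abs_nonneg _).trans (hJ.diag j)
  have hB : ∀ j, 0 ≤ B j := fun j => (abs_nonneg _).trans (hJ.offDiag j)
  have hN := fun v => partialNorm_nonneg hR.le n v
  refine le_majorant (x := fun j => partialNorm R n (J.scaledDiag j))
    (y := fun j => partialNorm R n (fun k => J.scaledDiag (j + 1) k - J.scaledDiag j k))
    (sq_nonneg R) hA hB ?_ ?_ (fun j => ?_) (fun j => ?_) j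
  · rcases n with _ | n
    · simp [partialNorm]
    · simp [partialNorm, scaledDiag_zero, Finset.sum_range_succ']
  · simp only [zero_add, scaledDiag_diff_zero]
    refine le_trans ?_ (hJ.diag 0)
    rcases n with _ | _ | n
    · simp [partialNorm]
    · simp [partialNorm]
    · simp [partialNorm, Finset.sum_range_succ', -abs_mul]
      exact mul_le_of_le_one_right (abs_nonneg _) hR1.le
  · have h := partialNorm_add_le hR.le n (J.scaledDiag j)
      (fun k => J.scaledDiag (j + 1) k - J.scaledDiag j k)
    simpa only [add_sub_cancel] using h
  · set e := J.scaledDiag j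
    set e' := J.scaledDiag (j + 1)
    have h1 : partialNorm R n (fun k => J.scaledDiag (j + 2) k - e' k) ≤
        partialNorm R n (fun k => rightShift (rightShift fun l => e' l - e l) k -
          (4 * J.β j ^ 2 - 1) * rightShift (rightShift e) k -
          2 * J.α (j + 1) * rightShift e' k) := by
      refine partialNorm_mono hR.le n fun k => ?_
      -- The recurrence can fail for k > j + 2, but there the left side vanishes, so an inequality
      -- of absolute values survives.
      rcases le_or_gt k (j + 2) with hk | hk
      · exact le_of_eq (congrArg abs (J.scaledDiag_diff_succ hk))
      · have h : e' k = 0 := J.scaledDiag_eq_zero (by omega)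
        rw [J.scaledDiag_eq_zero hk, h, sub_zero, abs_zero]
        exact abs_nonneg _
    have h2 := partialNorm_sub_le hR.le n
      (fun k => rightShift (rightShift fun l => e' l - e l) k -
          (4 * J.β j ^ 2 - 1) * rightShift (rightShift e) k)
      (fun k => 2 * J.α (j + 1) * rightShift e' k)
    have h3 := partialNorm_sub_le hR.le n (rightShift (rightShift fun l => e' l - e l))
      (fun k => (4 * J.β j ^ 2 - 1) * rightShift (rightShift e) k)
    rw [partialNorm_smul] at h2 h3
    have h4 := hshift2 fun l => e' l - e l
    have h5 : |4 * J.β j ^ 2 - 1| * partialNorm R n (rightShift (rightShift e)) ≤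
        B j * (R ^ 2 * partialNorm R n e) :=
      mul_le_mul (hJ.offDiag j) (hshift2 e) (hN _) (hB j)
    have h6 : |2 * J.α (j + 1)| * partialNorm R n (rightShift e') ≤
        A (j + 1) * partialNorm R n e' :=
      mul_le_mul (hJ.diag _) ((partialNorm_rightShift_le hR.le n e').trans
        (mul_le_of_le_one_left (hN _) hR1.le)) (hN _) (hA _)
    change partialNorm R n (fun k => J.scaledDiag (j + 2) k - e' k) ≤ _
    linarith

theorem Dominated.abs_prod_inv_le (hJ : J.Dominated A B U) (hU : Summable U) (j : ℕ) :
    |∏ l ∈ Finset.range j, (2 * J.β l)⁻¹| ≤ Real.exp (∑' l, U l) := by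
  have hU0 : ∀ l, 0 ≤ U l := fun l => (abs_nonneg _).trans (hJ.ratio l)
  rw [Finset.abs_prod]
  calc _ ≤ ∏ l ∈ Finset.range j, (1 + U l) := by
        refine Finset.prod_le_prod (fun _ _ => abs_nonneg _) fun l _ => ?_
        have h := abs_add_le 1 ((2 * J.β l)⁻¹ - 1)
        rw [add_sub_cancel, abs_one] at h
        linarith [hJ.ratio l]
    _ ≤ Real.exp (∑ l ∈ Finset.range j, U l) := Real.prod_one_add_le_exp_sum _ hU0
    _ ≤ _ := Real.exp_le_exp.mpr (hU.sum_le_tsum _ fun l _ => hU0 l)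

theorem connDiag_eq (J : JacobiOperator) (j k : ℕ) :
    J.connDiag j k = (∏ l ∈ Finset.range j, (2 * J.β l)⁻¹) * J.scaledDiag j k := by
  rw [scaledDiag, ← mul_assoc, ← Finset.prod_mul_distrib]
  have h : ∀ l ∈ Finset.range j, (2 * J.β l)⁻¹ * (2 * J.β l) = 1 := fun l _ =>
    inv_mul_cancel₀ (mul_pos two_pos (J.β_pos l)).ne'
  rw [Finset.prod_congr rfl h, Finset.prod_const_one, one_mul]

/-- The columns of `C_{J → Δ}`, read off along the superdiagonals, have summable increments,
uniformly in `J`. -/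
theorem exists_connDiag_increment_bound (hA : Summable A) (hB : Summable B) (hU : Summable U)
    (hA0 : ∀ j, 0 ≤ A j) (hB0 : ∀ j, 0 ≤ B j) (hU0 : ∀ j, 0 ≤ U j) (hR : 0 < R) (hR1 : R < 1) :
    ∃ Z : ℕ → ℝ, (∀ j, 0 ≤ Z j) ∧ Summable Z ∧ ∀ J : JacobiOperator, J.Dominated A B U →
      ∀ n j, partialNorm R n (fun k => J.connDiag (j + 1) k - J.connDiag j k) ≤ Z j := by
  have hρ1 : R ^ 2 < 1 := by nlinarith
  obtain ⟨b, hb⟩ := exists_majorant_le (sq_nonneg R) hρ1 hA0 hB0 hA hB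
  have hY := summable_majorant (sq_nonneg R) hρ1 hA0 hB0 hA hB
  have hnn := majorant_nonneg (sq_nonneg R) hA0 hB0
  have hb0 : 0 ≤ b := (hnn 0).1.trans (hb 0)
  refine ⟨fun j => Real.exp (∑' l, U l) * (U j * b + (majorant (R ^ 2) A B j).2), fun j => ?_,
    ((hU.mul_right b).add hY).mul_left _, fun J hJ n j => ?_⟩
  · have := hU0 j
    have := (hnn j).2
    positivity
  -- Product rule: the increment splits into that of the normalising product and that of the scaled
  -- column.
  · have h : (fun k => J.connDiag (j + 1) k - J.connDiag j k) = fun k =>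
        (∏ l ∈ Finset.range j, (2 * J.β l)⁻¹) * (((2 * J.β j)⁻¹ - 1) * J.scaledDiag (j + 1) k +
          (J.scaledDiag (j + 1) k - J.scaledDiag j k)) := by
      funext k
      rw [connDiag_eq, connDiag_eq, Finset.prod_range_succ]
      ring
    rw [h, partialNorm_smul]
    refine mul_le_mul (hJ.abs_prod_inv_le hU j) ?_ (partialNorm_nonneg hR.le n _)
      (Real.exp_pos _).le
    refine (partialNorm_add_le hR.le n _ _).trans
      (add_le_add ?_ (hJ.scaledDiag_le hR hR1 n j).2)
    rw [partialNorm_smul]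
    exact mul_le_mul (hJ.ratio j) ((hJ.scaledDiag_le hR hR1 n (j + 1)).1.trans (hb _))
      (partialNorm_nonneg hR.le n _) (hU0 j)

theorem Dominated.truncation (hJ : J.Dominated A B U) (m : ℕ) :
    (J.truncation m).Dominated A B U where
  diag k := by
    unfold JacobiOperator.truncation
    dsimp only
    split_ifs
    · exact hJ.diag k
    · simpa using (abs_nonneg _).trans (hJ.diag k)
  offDiag k := by
    unfold JacobiOperator.truncation
    dsimp only
    split_ifs
    · exact hJ.offDiag k
    · have := (abs_nonneg _).trans (hJ.offDiag k)
      norm_num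
      exact this
  ratio k := by
    unfold JacobiOperator.truncation
    dsimp only
    split_ifs
    · exact hJ.ratio k
    · simpa using (abs_nonneg _).trans (hJ.ratio k)

/-- Pⱼ involves αₗ and βₗ only for l < j, while truncation keeps βₗ only for l + 1 < m. For m = 0
the range is just j = 0, where both sides are 1. -/
theorem poly_truncation (J : JacobiOperator) (m : ℕ) :
    ∀ j, j ≤ m - 1 → (J.truncation m).poly j = J.poly j
  | 0, _ => rfl
  | 1, h => by simp [poly, JacobiOperator.truncation, show 0 < m by omega, show 1 < m by omega]
  | j + 2, h => by
    rw [poly, poly, poly_truncation J m j (by omega), poly_truncation J m (j + 1) (by omega)]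
    simp [JacobiOperator.truncation, show j + 1 < m by omega, show j + 1 + 1 < m by omega]

theorem connDiag_truncation (J : JacobiOperator) {m j : ℕ} (h : j ≤ m - 1) :
    (J.truncation m).connDiag j = J.connDiag j := by
  funext k
  simp only [connDiag, connection, J.poly_truncation m j h]

/-- Once the coefficients are free, the increment recurrence reduces to S², so each further column
adds two leading zeros to the increment. -/
theorem scaledDiag_truncation_diff (J : JacobiOperator) (m : ℕ) : ∀ j k, k + 2 * m < 2 * j + 2 →
    (J.truncation m).scaledDiag (j + 1) k = (J.truncation m).scaledDiag j k
  | 0, k, h => by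
    rw [← sub_eq_zero, scaledDiag_diff_zero]
    simp [JacobiOperator.truncation, show m = 0 by omega]
  | j + 1, k, h => by
    rcases le_or_gt k (j + 2) with hk | hk
    · have hβ : (J.truncation m).β j = 1 / 2 := if_neg (by omega)
      have hα : (J.truncation m).α (j + 1) = 0 := if_neg (by omega)
      rw [← sub_eq_zero, scaledDiag_diff_succ _ hk, hβ, hα]
      rcases k with _ | _ | k
      · norm_num [rightShift]
      · norm_num [rightShift]
      · have := J.scaledDiag_truncation_diff m j k (by omega)
        norm_num [rightShift, this]
    · rw [scaledDiag_eq_zero _ hk, scaledDiag_eq_zero _ (by omega)]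

/-- Column j + 1 has its entries at k ≤ j + 1, and the zeros of the increment cover all of these as
soon as 2m ≤ j. -/
theorem connDiag_truncation_eq_of_le (J : JacobiOperator) {m j : ℕ} (h : 2 * m ≤ j) :
    (J.truncation m).connDiag j = (J.truncation m).connDiag (2 * m) := by
  induction j, h using Nat.le_induction with
  | base => rfl
  | succ j hj ih =>
    rw [← ih]
    funext k
    have hβ : (J.truncation m).β j = 1 / 2 := if_neg (by omega)
    have he : (J.truncation m).scaledDiag (j + 1) k = (J.truncation m).scaledDiag j k := by
      rcases le_or_gt k (j + 1) with hk | hk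
      · exact J.scaledDiag_truncation_diff m j k (by omega)
      · rw [scaledDiag_eq_zero _ hk, scaledDiag_eq_zero _ (by omega)]
    rw [connDiag_eq, connDiag_eq, Finset.prod_range_succ, hβ, he]
    norm_num

theorem exists_dominated (J : JacobiOperator) (hα : Summable fun k => |J.α k|)
    (hβ : Summable fun k => |J.β k - 1 / 2|) :
    ∃ A B U : ℕ → ℝ, Summable A ∧ Summable B ∧ Summable U ∧ J.Dominated A B U := by
  refine ⟨fun k => |2 * J.α k|, fun k => |4 * J.β k ^ 2 - 1|, fun k => |(2 * J.β k)⁻¹ - 1|,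
    ?_, ?_, ?_, ⟨fun _ => le_rfl, fun _ => le_rfl, fun _ => le_rfl⟩⟩
  · simpa only [abs_mul] using hα.mul_left |2|
  · obtain ⟨b, hb⟩ := J.bounded
    refine Summable.of_nonneg_of_le (fun _ => abs_nonneg _) (fun k => ?_)
      (hβ.mul_left (4 * (b + 1)))
    have h1 := (le_abs_self _).trans (hb k).2
    have h2 := J.β_pos k
    have h3 : 4 * J.β k ^ 2 - 1 = (4 * (J.β k + 1 / 2)) * (J.β k - 1 / 2) := by ring
    rw [h3, abs_mul, abs_of_pos (by linarith : 0 < 4 * (J.β k + 1 / 2))]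
    exact mul_le_mul_of_nonneg_right (by linarith) (abs_nonneg _)
  · refine Summable.of_norm_bounded_eventually_nat (hβ.mul_left 4) ?_
    -- Summability forces βₖ → 1/2, so eventually βₖ > 1/4 and its inverse is at most 4.
    have h0 := hβ.tendsto_atTop_zero.eventually_lt_const (by norm_num : (0 : ℝ) < 1 / 4)
    filter_upwards [h0] with k hk
    have h2 := J.β_pos k
    have h3 : 1 / 4 < J.β k := by linarith [(abs_lt.mp hk).1]
    have h4 : (2 * J.β k)⁻¹ - 1 = - ((J.β k)⁻¹ * (J.β k - 1 / 2)) := by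
      field_simp
      ring
    rw [Real.norm_eq_abs, abs_abs, h4, abs_neg, abs_mul, abs_of_pos (inv_pos.mpr h2)]
    refine mul_le_mul_of_nonneg_right ?_ (abs_nonneg _)
    rw [inv_le_comm₀ h2 (by norm_num)]
    linarith

end JacobiOperator

/-! ### Limits of sequences with summable increments -/

section Increments

variable {R : ℝ} {g : ℕ → ℕ → ℝ} {Z : ℕ → ℝ}

theorem partialNorm_sub_le_tail (hR : 0 ≤ R) (hZ0 : ∀ j, 0 ≤ Z j) (hZ : Summable Z)
    (hg : ∀ n j, partialNorm R n (fun k => g (j + 1) k - g j k) ≤ Z j) (n : ℕ) {q j : ℕ}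
    (hqj : q ≤ j) : partialNorm R n (fun k => g j k - g q k) ≤ ∑' l, Z (l + q) := by
  obtain ⟨i, rfl⟩ := Nat.exists_eq_add_of_le' hqj
  have h : partialNorm R n (fun k => g (i + q) k - g q k) ≤
      ∑ l ∈ Finset.range i, Z (l + q) := by
    clear hqj
    induction i with
    | zero => simp [partialNorm]
    | succ i ih =>
      rw [Finset.sum_range_succ]
      have h := partialNorm_add_le hR n (fun k => g (i + q) k - g q k)
        (fun k => g (i + q + 1) k - g (i + q) k)
      simp only [sub_add_sub_cancel'] at h
      rw [show i + 1 + q = i + q + 1 by omega]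
      linarith [hg n (i + q)]
  exact h.trans (((summable_nat_add_iff q).mpr hZ).sum_le_tsum _ fun l _ => hZ0 _)

theorem partialNorm_limit_sub_le_tail (hR : 0 ≤ R) (hZ0 : ∀ j, 0 ≤ Z j) (hZ : Summable Z)
    (hg : ∀ n j, partialNorm R n (fun k => g (j + 1) k - g j k) ≤ Z j) {t : ℕ → ℝ}
    (ht : ∀ k, Tendsto (fun j => g j k) atTop (𝓝 (t k))) (n q : ℕ) :
    partialNorm R n (fun k => t k - g q k) ≤ ∑' l, Z (l + q) := by
  have h : Tendsto (fun j => partialNorm R n (fun k => g j k - g q k)) atTop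
      (𝓝 (partialNorm R n (fun k => t k - g q k))) :=
    tendsto_finsetSum _ fun k _ => (((ht k).sub_const _).abs).mul_const _
  refine le_of_tendsto h ?_
  filter_upwards [eventually_ge_atTop q] with j hj
  exact partialNorm_sub_le_tail hR hZ0 hZ hg n hj

theorem exists_limit (hR : 0 < R) (hZ : Summable Z)
    (hg : ∀ n j, partialNorm R n (fun k => g (j + 1) k - g j k) ≤ Z j) :
    ∃ t : ℕ → ℝ, ∀ k, Tendsto (fun j => g j k) atTop (𝓝 (t k)) := by
  suffices h : ∀ k, ∃ a, Tendsto (fun j => g j k) atTop (𝓝 a) by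
    choose t ht using h
    exact ⟨t, ht⟩
  intro k
  refine cauchySeq_tendsto_of_complete
    (cauchySeq_of_dist_le_of_summable (fun j => Z j * (R ^ k)⁻¹) (fun j => ?_) (hZ.mul_right _))
  rw [dist_comm, Real.dist_eq, ← div_eq_mul_inv, le_div_iff₀ (pow_pos hR k)]
  refine le_trans ?_ (hg (k + 1) j)
  exact Finset.single_le_sum (f := fun k => |g (j + 1) k - g j k| * R ^ k)
    (fun i _ => mul_nonneg (abs_nonneg _) (pow_nonneg hR.le i)) (Finset.self_mem_range_succ k)

end Increments

/-- The upper triangular matrix with entry `g j k` in column `j` on the `k`-th superdiagonal. -/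
def ofSuperdiagonals (g : ℕ → ℕ → ℝ) : Matrix ℕ ℕ ℝ := fun i j => if i ≤ j then g j (j - i) else 0

theorem ofSuperdiagonals_sub (g h : ℕ → ℕ → ℝ) :
    ofSuperdiagonals g - ofSuperdiagonals h = ofSuperdiagonals fun j k => g j k - h j k := by
  ext i j
  simp only [Matrix.sub_apply, ofSuperdiagonals]
  split_ifs <;> simp

/-- Substituting i = j - k turns the weight R⁻ⁱ into R⁻ʲ Rᵏ. -/
theorem columnBound_ofSuperdiagonals {R b : ℝ} (hR : 0 < R) {g : ℕ → ℕ → ℝ}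
    (hg : ∀ n j, partialNorm R n (g j) ≤ b) :
    ColumnBound ⟨R⁻¹, inv_pos.mpr hR⟩ (ofSuperdiagonals g) b := by
  intro j n
  have hnn : ∀ i, 0 ≤ |ofSuperdiagonals g i j| * R⁻¹ ^ i := fun i =>
    mul_nonneg (abs_nonneg _) (pow_nonneg (inv_nonneg.mpr hR.le) i)
  calc ∑ i ∈ Finset.range n, |ofSuperdiagonals g i j| * R⁻¹ ^ i
      ≤ ∑ i ∈ Finset.range (n + (j + 1)), |ofSuperdiagonals g i j| * R⁻¹ ^ i :=
        Finset.sum_le_sum_of_subset_of_nonneg (Finset.range_mono (by omega)) fun i _ _ => hnn i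
    _ = ∑ i ∈ Finset.range (j + 1), |ofSuperdiagonals g i j| * R⁻¹ ^ i := by
        refine (Finset.sum_subset (Finset.range_mono (by omega)) fun i _ hi => ?_).symm
        simp [ofSuperdiagonals, show ¬ i ≤ j by simpa [Nat.lt_succ_iff] using hi]
    _ = ∑ k ∈ Finset.range (j + 1), |ofSuperdiagonals g (j - k) j| * R⁻¹ ^ (j - k) :=
        (Finset.sum_range_reflect (fun i => |ofSuperdiagonals g i j| * R⁻¹ ^ i) (j + 1)).symm
    _ = partialNorm R (j + 1) (g j) * R⁻¹ ^ j := by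
        rw [partialNorm, Finset.sum_mul]
        refine Finset.sum_congr rfl fun k hk => ?_
        have hkj : k ≤ j := Nat.lt_succ_iff.mp (Finset.mem_range.mp hk)
        rw [ofSuperdiagonals, if_pos (Nat.sub_le j k), Nat.sub_sub_self hkj, mul_assoc,
          pow_sub₀ _ (inv_ne_zero hR.ne') hkj, inv_pow, inv_pow, inv_inv, mul_comm (R ^ k)]
    _ ≤ b * R⁻¹ ^ j :=
        mul_le_mul_of_nonneg_right (hg _ j) (pow_nonneg (inv_nonneg.mpr hR.le) j)

theorem isUpperTriangular_ofSuperdiagonals (g : ℕ → ℕ → ℝ) :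
    IsUpperTriangular (ofSuperdiagonals g) := fun _ _ h => if_neg (not_le.mpr h)

theorem isToeplitz_ofSuperdiagonals (t : ℕ → ℝ) : IsToeplitz (ofSuperdiagonals fun _ => t) := by
  intro i j
  simp [ofSuperdiagonals]

/-! ### Comparison of C with the matrices of the truncations -/

namespace JacobiOperator

theorem connection_free_eq (J : JacobiOperator) :
    J.connection free = ofSuperdiagonals J.connDiag := by
  ext i j
  simp only [ofSuperdiagonals, connDiag]
  split_ifs with h h'
  · rw [Nat.sub_sub_self h]
  · omega
  · exact J.connection_upperTriangular free i j (not_le.mp h)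

/-- The Toeplitz part of `C_{J → Δ}` for the truncations of `J`. -/
def truncToeplitz (J : JacobiOperator) (m : ℕ) : Matrix ℕ ℕ ℝ :=
  ofSuperdiagonals fun _ => (J.truncation m).connDiag (2 * m)

theorem finite_support_connection_sub_truncToeplitz (J : JacobiOperator) (m : ℕ) :
    {p : ℕ × ℕ | ((J.truncation m).connection free - J.truncToeplitz m) p.1 p.2 ≠ 0}.Finite := by
  refine (Finset.finite_toSet (Finset.range (2 * m) ×ˢ Finset.range (2 * m))).subset ?_
  rintro ⟨i, j⟩ h
  rw [Set.mem_ofPred_eq, connection_free_eq, truncToeplitz, ofSuperdiagonals_sub,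
    ofSuperdiagonals] at h
  split_ifs at h with hij
  · have hj : j < 2 * m := by
      by_contra hj
      rw [J.connDiag_truncation_eq_of_le (not_lt.mp hj), sub_self] at h
      exact h rfl
    simp only [Finset.coe_product, Finset.coe_range, Set.mem_prod, Set.mem_Iio]
    omega
  · exact absurd rfl h

variable {J : JacobiOperator} {R : ℝ} {Z : ℕ → ℝ}

theorem partialNorm_connDiag_le (hR : 0 ≤ R) (hZ0 : ∀ j, 0 ≤ Z j) (hZ : Summable Z)
    (hJ : ∀ n j, partialNorm R n (fun k => J.connDiag (j + 1) k - J.connDiag j k) ≤ Z j)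
    (n j : ℕ) : partialNorm R n (J.connDiag j) ≤ 1 + ∑' l, Z l := by
  have h0 : partialNorm R n (J.connDiag 0) ≤ 1 := by
    rcases n with _ | n
    · simp [partialNorm]
    · simp [partialNorm, connDiag_zero, Finset.sum_range_succ']
  have h1 := partialNorm_sub_le_tail hR hZ0 hZ hJ n (Nat.zero_le j)
  have h2 := partialNorm_add_le hR n (J.connDiag 0) fun k => J.connDiag j k - J.connDiag 0 k
  simp only [add_sub_cancel] at h2
  simp only [add_zero] at h1
  exact h2.trans (add_le_add h0 h1)

/-- Columns up to m - 1 agree; beyond, both matrices stay within the same tail of the common column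
m - 1. -/
theorem partialNorm_truncation_sub_le (hR : 0 ≤ R) (hZ0 : ∀ j, 0 ≤ Z j) (hZ : Summable Z)
    (hJ : ∀ n j, partialNorm R n (fun k => J.connDiag (j + 1) k - J.connDiag j k) ≤ Z j)
    {m : ℕ} (hm : ∀ n j, partialNorm R n
      (fun k => (J.truncation m).connDiag (j + 1) k - (J.truncation m).connDiag j k) ≤ Z j)
    (n j : ℕ) : partialNorm R n (fun k => (J.truncation m).connDiag j k - J.connDiag j k) ≤
      2 * ∑' l, Z (l + (m - 1)) := by
  rcases le_total j (m - 1) with h | h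
  · rw [J.connDiag_truncation h]
    simpa [partialNorm] using tsum_nonneg fun l => hZ0 (l + (m - 1))
  · have h1 := partialNorm_sub_le_tail hR hZ0 hZ hJ n h
    have h2 := partialNorm_sub_le_tail hR hZ0 hZ hm n h
    rw [J.connDiag_truncation le_rfl] at h2
    have h3 := partialNorm_sub_le hR n
      (fun k => (J.truncation m).connDiag j k - J.connDiag (m - 1) k)
      (fun k => J.connDiag j k - J.connDiag (m - 1) k)
    simp only [sub_sub_sub_cancel_right] at h3
    linarith

end JacobiOperator

end

/-! ### Assembly of the decomposition -/

theorem theorem5p8 (J : JacobiOperator) (K : EllTwo →L[ℂ] EllTwo)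
    (hJ : ∀ i j : ℕ, (J.matrix i j : ℂ) =
      (JacobiOperator.free.matrix i j : ℂ) + inner ℂ (stdE i) (K (stdE j)))
    (hK : IsTraceClass K) :
    ∃ (CToe Ccom : Matrix ℕ ℕ ℝ) (CToeTrunc CcomTrunc : ℕ → Matrix ℕ ℕ ℝ),
      IsToeplitzPlusCompact (J.connection JacobiOperator.free) CToe Ccom ∧
      (∀ m : ℕ,
        IsToeplitzPlusCompact ((J.truncation m).connection JacobiOperator.free)
          (CToeTrunc m) (CcomTrunc m) ∧
        {p : ℕ × ℕ | CcomTrunc m p.1 p.2 ≠ 0}.Finite) ∧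
      ∀ (R : ℝ) (hR : 0 < R), R < 1 →
        ConvergesOn ⟨R⁻¹, inv_pos.mpr hR⟩
          (fun m => (J.truncation m).connection JacobiOperator.free)
          (J.connection JacobiOperator.free) ∧
        ConvergesOn ⟨R⁻¹, inv_pos.mpr hR⟩ CToeTrunc CToe ∧
        ConvergesOn ⟨R⁻¹, inv_pos.mpr hR⟩ CcomTrunc Ccom := by
  obtain ⟨hα, hβ⟩ := JacobiOperator.summable_of_isTraceClass hJ hK
  obtain ⟨A, B, U, hA, hB, hU, hdom⟩ := J.exists_dominated hα hβ
  have hinc := fun (R : ℝ) (hR : 0 < R) (hR1 : R < 1) =>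
    JacobiOperator.exists_connDiag_increment_bound hA hB hU
      (fun j => (abs_nonneg _).trans (hdom.diag j)) (fun j => (abs_nonneg _).trans (hdom.offDiag j))
      (fun j => (abs_nonneg _).trans (hdom.ratio j)) hR hR1
  -- The limit is entrywise, hence independent of R; the value 1/2 serves only to prove existence.
  obtain ⟨t, ht⟩ : ∃ t : ℕ → ℝ, ∀ k, Tendsto (fun j => J.connDiag j k) atTop (𝓝 (t k)) := by
    obtain ⟨Z, -, hZ, h⟩ := hinc (1 / 2) (by norm_num) (by norm_num)
    exact exists_limit (by norm_num) hZ (h J hdom)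
  have key : ∀ (R : ℝ) (hR : 0 < R), R < 1 →
      (ConvergesOn ⟨R⁻¹, inv_pos.mpr hR⟩
        (fun m => (J.truncation m).connection JacobiOperator.free)
        (J.connection JacobiOperator.free) ∧
      ConvergesOn ⟨R⁻¹, inv_pos.mpr hR⟩ J.truncToeplitz (ofSuperdiagonals fun _ => t)) := by
    intro R hR hR1
    obtain ⟨Z, hZ0, hZ, h⟩ := hinc R hR hR1
    have hJinc := h J hdom
    have hminc := fun m => h _ (hdom.truncation m)
    have hbd := fun (J' : JacobiOperator) (h' : J'.Dominated A B U) =>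
      JacobiOperator.partialNorm_connDiag_le hR.le hZ0 hZ (h J' h')
    have htail : Tendsto (fun m : ℕ => ∑' l, Z (l + (m - 1))) atTop (𝓝 0) :=
      (tendsto_sum_nat_add Z).comp (tendsto_sub_atTop_nat 1)
    have hlim := partialNorm_limit_sub_le_tail hR.le hZ0 hZ hJinc ht
    have hdiff := fun m =>
      JacobiOperator.partialNorm_truncation_sub_le hR.le hZ0 hZ hJinc (hminc m)
    constructor
    · simp only [JacobiOperator.connection_free_eq]
      refine convergesOn_of_columnBound (ε := fun m => 2 * ∑' l, Z (l + (m - 1)))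
        (fun m => (columnBound_ofSuperdiagonals hR (hbd _ (hdom.truncation m))).isBoundedOn)
        (columnBound_ofSuperdiagonals hR (hbd J hdom)).isBoundedOn (fun m => ?_)
        (by simpa using htail.const_mul 2)
      rw [ofSuperdiagonals_sub]
      exact columnBound_ofSuperdiagonals hR (hdiff m)
    · have htbd : ∀ n, partialNorm R n t ≤ (∑' l, Z l) + (1 + ∑' l, Z l) := fun n => by
        have h2 := partialNorm_add_le hR.le n (fun k => t k - J.connDiag 0 k) (J.connDiag 0)
        simp only [sub_add_cancel] at h2
        exact h2.trans (add_le_add (hlim n 0) (hbd J hdom n 0))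
      -- Both symbols are compared with column 2m of C: the first tail bounds the effect of
      -- truncation, the second the distance to the limit t.
      refine convergesOn_of_columnBound
        (ε := fun m => 2 * ∑' l, Z (l + (m - 1)) + ∑' l, Z (l + 2 * m))
        (fun m => (columnBound_ofSuperdiagonals hR fun n _ =>
          hbd _ (hdom.truncation m) n (2 * m)).isBoundedOn)
        (columnBound_ofSuperdiagonals hR fun n _ => htbd n).isBoundedOn (fun m => ?_) ?_
      · rw [JacobiOperator.truncToeplitz, ofSuperdiagonals_sub]
        refine columnBound_ofSuperdiagonals hR fun n _ => ?_
        have h2 := partialNorm_sub_le hR.le n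
          (fun k => (J.truncation m).connDiag (2 * m) k - J.connDiag (2 * m) k)
          (fun k => t k - J.connDiag (2 * m) k)
        simp only [sub_sub_sub_cancel_right] at h2
        exact h2.trans (add_le_add (hdiff m n _) (hlim n _))
      · have h2 : Tendsto (fun m : ℕ => ∑' l, Z (l + 2 * m)) atTop (𝓝 0) :=
          (tendsto_sum_nat_add Z).comp (tendsto_id.const_mul_atTop' two_pos)
        simpa using (htail.const_mul 2).add h2
  -- The compact parts are defined as differences, so their convergence follows by subtraction.
  have hconv := fun R hR hR1 => (key R hR hR1).1.sub (key R hR hR1).2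
  have hfin := J.finite_support_connection_sub_truncToeplitz
  refine ⟨ofSuperdiagonals fun _ => t,
    J.connection JacobiOperator.free - ofSuperdiagonals fun _ => t, J.truncToeplitz,
    fun m => (J.truncation m).connection JacobiOperator.free - J.truncToeplitz m,
    ⟨(add_sub_cancel _ _).symm, isUpperTriangular_ofSuperdiagonals _,
      isToeplitz_ofSuperdiagonals t, fun R hR hR1 => ?_, fun R hR hR1 =>
        (hconv R hR hR1).isCompactOn hfin⟩,
    fun m => ⟨⟨(add_sub_cancel _ _).symm, isUpperTriangular_ofSuperdiagonals _,
      isToeplitz_ofSuperdiagonals _, fun R hR hR1 => ?_, fun R hR hR1 => ?_⟩, hfin m⟩,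
    fun R hR hR1 => ⟨(key R hR hR1).1, (key R hR hR1).2, hconv R hR hR1⟩⟩
  · obtain ⟨_, B, _, hB, _⟩ := (key R hR hR1).2
    exact ⟨B, hB⟩
  · obtain ⟨A, _, hA, _⟩ := (key R hR hR1).2
    exact ⟨A m, hA m⟩
  · obtain ⟨A, _, hA, _⟩ := hconv R hR hR1
    exact IsBoundedOn.isCompactOn ⟨A m, hA m⟩ (hfin m)
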